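/- Setting. Let $n\in\{2,3\}$ and let $\Omega\subset\mathbb R^n$ be a bounded domain, decomposed into finitely many pairwise disjoint, connected, flat subdomains $\Omega_i^d$ ($0\le d\le n$, $i\in I^d$), where $\Omega_i^d$ is relatively open in a $d$-dimensional affine subspace (for $d<n$: fractures and their intersections). Each side of $\Omega_i^d$ on which a $(d+1)$-dimensional subdomain lies is an interface $\Gamma_{ij}^d$, $j\in J_i^d$ (geometrically a copy of $\Omega_i^d$); $\Omega^d=\bigcup_i\Omega_i^d$, $\Gamma^d=\bigcup_{i,j}\Gamma_{ij}^d$. Let $\partial\Omega=\partial\Omega_D\cup\partial\Omega_N$ be a disjoint partition with $\partial\Omega_D$ of positive measure. Let $K$ be a symmetric positive definite tensor, constant on each subdomain, let $\gamma>0$ be constant on each interface, and let $K_\nu>0$ be bounded above and away from zero on each interface. Let $\mathcal T_\Omega^d$, $\mathcal T_\Gamma^d$ be simplicial triangulations of $\Omega^d$ and $\Gamma^d$, where the facets of $\mathcal T_\Omega^{d}$ resolve the interfaces, $\partial\Omega_D$ and $\partial\Omega_N$, and $\mathcal T_\Gamma^d$ need not match the other meshes. Say that $\mathcal T_\Omega$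 is shape regular with constant $\sigma$ if $\operatorname{diam}T\le\sigma\rho_T$ for each simplex $T$ of positive dimension, $\rho_T$ being the diameter of its inscribed ball. Let $\boldsymbol V_h^d=\mathbb{RT}_0(\mathcal T_\Omega^d)$ with $\boldsymbol v\cdot\boldsymbol\nu=0$ on $\partial\Omega_N$; let $\boldsymbol V_{0h}^d\subset\boldsymbol V_h^d$ be the subspace with $\boldsymbol v\cdot\boldsymbol\nu=0$ on $\Gamma^{d-1}$; and let $\Lambda_h^d=\mathbb P_0(\mathcal T_\Gamma^d)$, $Q_h^d=\mathbb P_0(\mathcal T_\Omega^d)$. Put $\boldsymbol V_{0h}=\bigoplus_{d=1}^n\boldsymbol V_{0h}^d$, $\Lambda_h=\bigoplus_{d=0}^{n-1}\Lambda_h^d$, $Q_h=\bigoplus_{d=0}^nQ_h^d$, $\boldsymbol W_h=\boldsymbol V_{0h}\times\Lambda_h$. Let $R_h=\bigoplus_d R_h^d$, where $R_h^d:\Lambda_h^d\to\boldsymbol V_h^{d+1}$ is a linear operator such that $R_h^d\mu\cdot\boldsymbol\nu$ equals, on $\Gamma^d$, the $L^2(\Gamma^d)$-projection of $\mu$ onto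 $\boldsymbol V_h^{d+1}\cdot\boldsymbol\nu|_{\Gamma^d}$, and is zero on the rest of the boundary. For $\boldsymbol w=[\boldsymbol u_0,\lambda]$ and $\boldsymbol r=[\boldsymbol v_0,\mu]$ in $\boldsymbol W_h$ and $q\in Q_h$, with $\boldsymbol u=\boldsymbol u_0+R_h\lambda$ and $\boldsymbol v=\boldsymbol v_0+R_h\mu$, put $$a(\boldsymbol w,\boldsymbol r)=(K^{-1}\boldsymbol u,\boldsymbol v)_\Omega+(\gamma K_\nu^{-1}\lambda,\mu)_\Gamma,\qquad b(\boldsymbol r,q)=-(q,\nabla\cdot\boldsymbol v+[\![\mu]\!])_\Omega,\qquad [\![\mu]\!]|_{\Omega_i^d}=-\sum_{j}\mu_{ij}^d,$$ $$a^D(\boldsymbol w,\boldsymbol r)=\sum_{d=1}^n\sum_{T\in\mathcal T_\Omega^d}\sum_{f\subset\partial T}(\boldsymbol u\cdot\boldsymbol\nu_f)(\boldsymbol v\cdot\boldsymbol\nu_f)(K^{-1}\boldsymbol\phi_f,\boldsymbol\phi_f)_T+(\gamma K_\nu^{-1}\lambda,\mu)_\Gamma,$$ where $\boldsymbol\phi_f\in\mathbb{RT}_0(T)$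 is the basis function with normal component $1$ on the facet $f$ and $0$ on the other facets. Put $\|\boldsymbol r\|_a=a(\boldsymbol r,\boldsymbol r)^{1/2}$, $\|\boldsymbol r\|_{a^D}=a^D(\boldsymbol r,\boldsymbol r)^{1/2}$. The discrete gradient $\boldsymbol D_h:Q_h\to\boldsymbol W_h$ is the linear operator with $a^D(\boldsymbol D_hq,\boldsymbol r)=b(\boldsymbol r,q)$ for all $\boldsymbol r\in\boldsymbol W_h$, $q\in Q_h$. Statement. For every $\sigma$ there is a constant $c_2>0$, depending only on $\sigma$, such that for all $n$, geometries, meshes and parameters as above with $\mathcal T_\Omega$ shape regular with constant $\sigma$: operators $R_h$ as above exist, and, for each of them, $\|\boldsymbol r\|_a\le c_2\|\boldsymbol r\|_{a^D}$ for all $\boldsymbol r\in\boldsymbol W_h$, the discrete gradient $\boldsymbol D_h$ exists and is unique, and with $\beta_\star=c_2^{-1}$, $$\inf_{q\in Q_h,\ \boldsymbol D_hq\neq0}\ \sup_{0\neq\boldsymbol r\in\boldsymbol W_h}\frac{a^D(\boldsymbol D_hq,\boldsymbol r)}{\|\boldsymbol r\|_a\,\|\boldsymbol D_hq\|_{a^D}}\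 \ge\ \beta_\star .$$ In particular $\beta_\star$ is independent of the mesh size and of $K$, $K_\nu$, $\gamma$. -/

import Mathlib

open MeasureTheory Topology Module

noncomputable section

namespace MixedDim

/-! ### Mixed-dimensional geometry -/

/-- The ambient Euclidean space `ℝⁿ`. -/
abbrev Space (n : ℕ) : Type := EuclideanSpace ℝ (Fin n)

/-- A finite family of flat subdomains `Ω_i^d` (`i ∈ I^d`) of `ℝⁿ`: each `Ω_i^d` is a
connected, relatively open, non-empty subset of a `d`-dimensional affine subspace, and
the subdomains are pairwise disjoint. (For `d > n` the index set `I^d` is automatically empty; for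
`d = 0` a subdomain is a point.) -/
structure Decomposition (n : ℕ) where
  I : ℕ → Type
  fintypeI : ∀ d, Fintype (I d)
  /-- the affine subspace (the plane of `Ω_i^d`) -/
  aff : ∀ d, I d → AffineSubspace ℝ (Space n)
  finrank_aff : ∀ d i, finrank ℝ (aff d i).direction = d
  /-- the subdomain `Ω_i^d` -/
  dom : ∀ d, I d → Set (Space n)
  dom_relOpen : ∀ d i, ∃ U : Set (Space n), IsOpen U ∧ dom d i = U ∩ (aff d i : Set (Space n))
  dom_connected : ∀ d i, IsConnected (dom d i)
  dom_disjoint : Pairwise fun p q : (Σ d, I d) => Disjoint (dom p.1 p.2) (dom q.1 q.2)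

attribute [instance] Decomposition.fintypeI

namespace Decomposition

variable {n : ℕ} (G : Decomposition n)

/-- `Ω = ⋃_d ⋃_i Ω_i^d`. -/
def omega : Set (Space n) := ⋃ d, ⋃ i, G.dom d i

/-- The tangent space of `Ω_i^d`. -/
abbrev dir (d : ℕ) (i : G.I d) : Submodule ℝ (Space n) := (G.aff d i).direction

/-- Seen from the point `x` against the direction `e`, one enters the `(d+1)`-dimensional subdomain
`Ω_k^{d+1}`: thus `e` points out of `Ω_k^{d+1}` at `x`. -/
def SideAt {d : ℕ} (x : Space n) (k : G.I (d + 1)) (e : Space n) : Prop :=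
  ∀ᶠ s in 𝓝[>] (0 : ℝ), x - s • e ∈ G.dom (d + 1) k

end Decomposition

/-- The fractured porous medium. `Ω` is a bounded domain of `ℝⁿ`, decomposed into the subdomains
`Ω_i^d`. For each `Ω_i^d`, the set `J d i` enumerates the interfaces `Γ_{ij}^d`. An interface is one
side of `Ω_i^d`: it has the same location as `Ω_i^d` and is the part of the boundary of the
`(d+1)`-dimensional subdomain `up d i j` which lies on that side; `normal d i j` is the unit normal
on it that points out of `up d i j`. Both sides of a fracture may belong to the same
`(d+1)`-dimensional subdomain. The boundary `∂Ω` (which contains immersed fracture tips) is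
partitioned into a Dirichlet part of positive measure and a Neumann part. -/
structure Geometry (n : ℕ) extends Decomposition n where
  omega_open : IsOpen toDecomposition.omega
  omega_connected : IsConnected toDecomposition.omega
  omega_bounded : Bornology.IsBounded toDecomposition.omega
  J : ∀ d, I d → Type
  fintypeJ : ∀ d i, Fintype (J d i)
  up : ∀ d i, J d i → I (d + 1)
  normal : ∀ d i, J d i → Space n
  normal_unit : ∀ d i j, ‖normal d i j‖ = 1
  normal_orth : ∀ d i j, ∀ v ∈ (aff d i).direction, inner ℝ v (normal d i j) = 0
  normal_side : ∀ d i j, ∀ x ∈ dom d i, toDecomposition.SideAt x (up d i j) (normal d i j)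
  /-- every side of `Ω_i^d` is listed exactly once -/
  side_unique : ∀ d i, ∀ x ∈ dom d i, ∀ (k : I (d + 1)) (e : Space n), ‖e‖ = 1 →
    (∀ v ∈ (aff d i).direction, inner ℝ v e = 0) → toDecomposition.SideAt x k e →
    ∃! j : J d i, up d i j = k ∧ normal d i j = e
  bdD : Set (Space n)
  bdN : Set (Space n)
  bd_union : bdD ∪ bdN = frontier toDecomposition.omega
  bd_disjoint : Disjoint bdD bdN
  bdD_pos : 0 < μHE[n - 1] bdD

attribute [instance] Geometry.fintypeJ

/-- The physical parameters: on each subdomain a constant symmetric positive definite permeability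
tensor `K` acting on tangential vectors, on each interface a normal permeability `K_ν`, bounded from
above and away from zero, and a constant `γ > 0`. -/
structure Params {n : ℕ} (G : Geometry n) where
  K : ∀ d (i : G.I d), G.dir d i ≃ₗ[ℝ] G.dir d i
  K_symm : ∀ d i u v, inner ℝ (K d i u) v = inner ℝ u (K d i v)
  K_pos : ∀ d i u, u ≠ 0 → 0 < inner ℝ (K d i u) u
  Kν : ∀ d (i : G.I d), G.J d i → Space n → ℝ
  Kν_measurable : ∀ d i j, Measurable (Kν d i j)
  Kν_bounds : ∀ d i j, ∃ m M : ℝ, 0 < m ∧ ∀ x ∈ closure (G.dom d i),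
    m ≤ Kν d i j x ∧ Kν d i j x ≤ M
  γ : ∀ d (i : G.I d), G.J d i → ℝ
  γ_pos : ∀ d i j, 0 < γ d i j

/-! ### Simplices and triangulations -/

/-- The relatively open simplex: all barycentric coordinates are positive (for `d = 0`, the
point). -/
def openCell {n d : ℕ} (t : Affine.Simplex ℝ (Space n) d) : Set (Space n) :=
  t.setInterior (Set.Ioi 0)

/-- The facet of a `(d+1)`-simplex opposite to its vertex `k`. -/
def facet {n d : ℕ} (t : Affine.Simplex ℝ (Space n) (d + 1)) (k : Fin (d + 2)) :
    Affine.Simplex ℝ (Space n) d :=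
  t.faceOpposite k

/-- The unit outer normal (in the plane of the simplex) on the facet opposite to the vertex `k`. -/
def outerNormal {n d : ℕ} (t : Affine.Simplex ℝ (Space n) (d + 1)) (k : Fin (d + 2)) : Space n :=
  (t.height k)⁻¹ • (t.altitudeFoot k - t.points k)

/-- A conforming triangulation of (the closure of) a relatively open set `S` by `d`-simplices.
Conformity is required inside `S`; the two sides of a slit of `S` need not match. -/
structure Triangulation {n : ℕ} (d : ℕ) (S : Set (Space n)) where
  ι : Type
  fintypeι : Fintype ι
  cell : ι → Affine.Simplex ℝ (Space n) d
  openCell_subset : ∀ t, openCell (cell t) ⊆ S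
  iUnion_cell : ⋃ t, (cell t).closedInterior = closure S
  disjoint : Pairwise fun t t' => Disjoint (openCell (cell t)) (openCell (cell t'))
  conforming : ∀ t t', S ∩ (cell t).closedInterior ∩ (cell t').closedInterior ⊆
    convexHull ℝ (Set.range (cell t).points ∩ Set.range (cell t').points)

attribute [instance] Triangulation.fintypeι

/-- The function which is constant on each open simplex, with the given values. -/
def Triangulation.toFun {n d : ℕ} {S : Set (Space n)} (T : Triangulation d S) (c : T.ι → ℝ)
    (x : Space n) : ℝ :=
  ∑ t, (openCell (T.cell t)).indicator (fun _ => c t) x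

/-- The meshes `𝒯_Ω` of the subdomains and `𝒯_Γ` of the interfaces (the mortar meshes), which need
not match. The mesh of `Ω^{d+1}` resolves the parts of its boundary: each of its facets lies inside
the subdomain, or on a `d`-dimensional subdomain, or on the Dirichlet or the Neumann boundary. -/
structure Mesh {n : ℕ} (G : Geometry n) where
  sub : ∀ d (i : G.I d), Triangulation d (G.dom d i)
  mortar : ∀ d (i : G.I d), G.J d i → Triangulation d (G.dom d i)
  facet_cases : ∀ d (i : G.I (d + 1)) (t : (sub (d + 1) i).ι) (k : Fin (d + 2)),
    openCell (facet ((sub (d + 1) i).cell t) k) ⊆ G.dom (d + 1) i ∨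
    (∃ i' : G.I d, openCell (facet ((sub (d + 1) i).cell t) k) ⊆ G.dom d i') ∨
    openCell (facet ((sub (d + 1) i).cell t) k) ⊆ G.bdD ∨
    openCell (facet ((sub (d + 1) i).cell t) k) ⊆ G.bdN

/-! ### Raviart–Thomas functions on one simplex -/

section Local

variable {n : ℕ} (S : Submodule ℝ (Space n))

/-- The lowest-order Raviart–Thomas space on a simplex with tangent space `S`: the pair `(a, b)`
stands for the tangential vector field `x ↦ a + b x` (see `RT.eval`). -/
abbrev RT : Type := S × ℝ

variable {S}

/-- The field `x ↦ a + b P x`, with the orthogonal projection `P` onto the tangent space `S`. On an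
affine subspace of direction `S`, the vector `P x` is `x` up to a constant. -/
def RT.eval (v : RT S) (x : Space n) : S := v.1 + v.2 • S.orthogonalProjectionOnto x

/-- The (tangential, constant) divergence of `x ↦ a + b P x` on a `(d+1)`-dimensional simplex. -/
def RT.div (d : ℕ) (v : RT S) : ℝ := ((d + 1 : ℕ) : ℝ) * v.2

/-- The normal component `v · ν_f` on the facet `f` opposite to the vertex `k`. It is constant on
the hyperplane of the facet, and taken here at the foot of the altitude. -/
def RT.flux {d : ℕ} (t : Affine.Simplex ℝ (Space n) (d + 1)) (k : Fin (d + 2)) (v : RT S) : ℝ :=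
  inner ℝ (v.eval (t.altitudeFoot k) : Space n) (outerNormal t k)

variable (S)

/-- The Raviart–Thomas basis function `φ_f(x) = (x - p_k) / h_k` of the facet `f` opposite to the
vertex `p_k`, of height `h_k`: its normal component is `1` on `f` and `0` on the other facets. -/
def RT.basis {d : ℕ} (t : Affine.Simplex ℝ (Space n) (d + 1)) (k : Fin (d + 2)) : RT S :=
  (-((t.height k)⁻¹ • S.orthogonalProjectionOnto (t.points k)), (t.height k)⁻¹)

end Local

namespace Mesh

variable {n : ℕ} {G : Geometry n} (M : Mesh G)

/-- Shape regularity of `𝒯_Ω` with constant `σ`: the diameter of each simplex is at most `σ` times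
the diameter of its inscribed ball. -/
def ShapeRegular (σ : ℝ) : Prop :=
  ∀ d (i : G.I (d + 1)) (t : (M.sub (d + 1) i).ι),
    Metric.diam ((M.sub (d + 1) i).cell t).closedInterior ≤
      σ * (2 * ((M.sub (d + 1) i).cell t).inradius)

/-! ### Discrete spaces -/

/-- `Q_h^d`: piecewise constants on the mesh of `Ω^d`. -/
abbrev Qd (d : ℕ) : Type := ∀ i : G.I d, (M.sub d i).ι → ℝ

/-- `Λ_h^d`: piecewise constants on the mortar mesh of `Γ^d`. -/
abbrev Ld (d : ℕ) : Type := ∀ (i : G.I d) (j : G.J d i), (M.mortar d i j).ι → ℝ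

/-- Fields on `Ω^{d+1}` that are Raviart–Thomas functions on each simplex, without any continuity
between simplices. -/
abbrev Xd (d : ℕ) : Type := ∀ i : G.I (d + 1), (M.sub (d + 1) i).ι → RT (G.dir (d + 1) i)

variable {M} in
/-- The normal component of a piecewise field on the facet `(t, k)`, outward from `t`. -/
def flux {d : ℕ} (v : M.Xd d) (i : G.I (d + 1)) (t : (M.sub (d + 1) i).ι) (k : Fin (d + 2)) : ℝ :=
  (v i t).flux ((M.sub (d + 1) i).cell t) k

/-- The facet of the simplex `t` opposite to its vertex `k`. -/
abbrev fct {d : ℕ} (i : G.I (d + 1)) (t : (M.sub (d + 1) i).ι) (k : Fin (d + 2)) :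
    Affine.Simplex ℝ (Space n) d :=
  facet ((M.sub (d + 1) i).cell t) k

/-- The facet `(t, k)` of the mesh of `up d i j` lies on the interface `Γ_{ij}^d`: it has the same
location and lies on the same side. -/
def OnInterface {d : ℕ} (i : G.I d) (j : G.J d i) (t : (M.sub (d + 1) (G.up d i j)).ι)
    (k : Fin (d + 2)) : Prop :=
  openCell (M.fct (G.up d i j) t k) ⊆ G.dom d i ∧
    outerNormal ((M.sub (d + 1) (G.up d i j)).cell t) k = G.normal d i j

/-- `V_h^{d+1}`, the lowest-order Raviart–Thomas space on `Ω^{d+1}`: the normal component is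
continuous across the facets inside each subdomain and vanishes on the Neumann boundary. -/
def Vd (d : ℕ) : Submodule ℝ (M.Xd d) where
  carrier := {v |
    (∀ (i : G.I (d + 1)) (t t' : (M.sub (d + 1) i).ι) (k k' : Fin (d + 2)), t ≠ t' →
      Set.range (M.fct i t k).points = Set.range (M.fct i t' k').points →
      openCell (M.fct i t k) ⊆ G.dom (d + 1) i → flux v i t k + flux v i t' k' = 0) ∧
    ∀ (i : G.I (d + 1)) (t : (M.sub (d + 1) i).ι) (k : Fin (d + 2)),
      openCell (M.fct i t k) ⊆ G.bdN → flux v i t k = 0}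
  add_mem' := by
    rintro v w ⟨hv, hv'⟩ ⟨hw, hw'⟩
    have key : ∀ i t k, flux (v + w) i t k = flux v i t k + flux w i t k := by
      intro i t k
      simp only [flux, RT.flux, RT.eval, Pi.add_apply, Prod.fst_add, Prod.snd_add, add_smul,
        Submodule.coe_add, inner_add_left]
      ring
    refine ⟨fun i t t' k k' h1 h2 h3 => ?_, fun i t k h => ?_⟩
    · rw [key, key]
      linarith [hv i t t' k k' h1 h2 h3, hw i t t' k k' h1 h2 h3]
    · rw [key, hv' i t k h, hw' i t k h, add_zero]
  zero_mem' := by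
    have key : ∀ i t k, flux (0 : M.Xd d) i t k = 0 := by
      intro i t k
      simp [flux, RT.flux, RT.eval]
    exact ⟨fun i t t' k k' _ _ _ => by rw [key, key, add_zero], fun i t k _ => key i t k⟩
  smul_mem' := by
    rintro c v ⟨hv, hv'⟩
    have key : ∀ i t k, flux (c • v) i t k = c * flux v i t k := by
      intro i t k
      simp only [flux, RT.flux, RT.eval, Pi.smul_apply, Prod.smul_fst, Prod.smul_snd, smul_assoc,
        ← smul_add, Submodule.coe_smul, real_inner_smul_left]
    refine ⟨fun i t t' k k' h1 h2 h3 => ?_, fun i t k h => ?_⟩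
    · rw [key, key, ← mul_add, hv i t t' k k' h1 h2 h3, mul_zero]
    · rw [key, hv' i t k h, mul_zero]

/-- `V_{0h}^{d+1}`: the functions of `V_h^{d+1}` whose normal component vanishes on `Γ^d`. -/
def V0d (d : ℕ) : Submodule ℝ (M.Xd d) where
  carrier := {v | v ∈ M.Vd d ∧
    ∀ (i : G.I d) (j : G.J d i) (t : (M.sub (d + 1) (G.up d i j)).ι) (k : Fin (d + 2)),
      M.OnInterface i j t k → flux v (G.up d i j) t k = 0}
  add_mem' := by
    rintro v w ⟨hv, hv'⟩ ⟨hw, hw'⟩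
    refine ⟨(M.Vd d).add_mem hv hw, fun i j t k h => ?_⟩
    have h1 := hv' i j t k h
    have h2 := hw' i j t k h
    simp only [flux, RT.flux, RT.eval, Pi.add_apply, Prod.fst_add, Prod.snd_add, add_smul,
      Submodule.coe_add, inner_add_left] at h1 h2 ⊢
    linarith
  zero_mem' := ⟨(M.Vd d).zero_mem, fun i j t k _ => by simp [flux, RT.flux, RT.eval]⟩
  smul_mem' := by
    rintro c v ⟨hv, hv'⟩
    refine ⟨(M.Vd d).smul_mem c hv, fun i j t k h => ?_⟩
    have h1 := hv' i j t k h
    simp only [flux, RT.flux, RT.eval, Pi.smul_apply, Prod.smul_fst, Prod.smul_snd, smul_assoc,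
      ← smul_add, Submodule.coe_smul, real_inner_smul_left] at h1 ⊢
    rw [h1, mul_zero]

/-- `Q_h = ⨁_{d=0}^n Q_h^d`. -/
abbrev Q : Type := ∀ d : Fin (n + 1), M.Qd d

/-- `Λ_h = ⨁_{d=0}^{n-1} Λ_h^d`. -/
abbrev L : Type := ∀ d : Fin n, M.Ld d

/-- `W_h = V_{0h} × Λ_h`, with `V_{0h} = ⨁_{d=1}^n V_{0h}^d`. -/
abbrev W : Type := (∀ d : Fin n, M.V0d d) × M.L

/-! ### The discrete extension operator -/

open Classical in
/-- `R_h^d : Λ_h^d → V_h^{d+1}` is a discrete extension operator: on `Γ^d`, the normal component of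
`R_h^d μ` is the `L²(Γ^d)`-projection of `μ` onto the space of normal traces of `V_h^{d+1}`, that
is, `(R_h^d μ · ν - μ, v · ν)_{Γ^d} = 0` for all `v ∈ V_h^{d+1}`; on the rest of the boundary of
`Ω^{d+1}` it is zero. -/
def IsExtension (d : ℕ) (R : M.Ld d →ₗ[ℝ] M.Vd d) : Prop :=
  (∀ (μ : M.Ld d) (v : M.Vd d),
    ∑ i : G.I d, ∑ j : G.J d i, ∑ t : (M.sub (d + 1) (G.up d i j)).ι, ∑ k : Fin (d + 2),
      (if M.OnInterface i j t k then
        ∫ x in (M.fct (G.up d i j) t k).closedInterior,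
          (flux (R μ : M.Xd d) (G.up d i j) t k - (M.mortar d i j).toFun (μ i j) x) *
            flux (v : M.Xd d) (G.up d i j) t k ∂μHE[d]
      else 0) = 0) ∧
  ∀ (μ : M.Ld d) (i : G.I (d + 1)) (t : (M.sub (d + 1) i).ι) (k : Fin (d + 2)),
    openCell (M.fct i t k) ⊆ G.bdD ∪ G.bdN → flux (R μ : M.Xd d) i t k = 0

variable {M}

/-- `v_{0h} + R_h μ_h` for `[v_{0h}, μ_h] ∈ W_h`, with `R_h = ⨁_d R_h^d`. -/
def total (R : ∀ d : Fin n, M.Ld d →ₗ[ℝ] M.Vd d) (r : M.W) (d : Fin n) : M.Xd d :=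
  (r.1 d : M.Xd d) + (R d (r.2 d) : M.Xd d)

/-! ### Bilinear forms -/

variable (P : Params G)

/-- `(γ K_ν⁻¹ λ, μ)_Γ`. -/
def formΓ (l m : M.L) : ℝ :=
  ∑ d : Fin n, ∑ i : G.I d, ∑ j : G.J d i, ∑ τ : (M.mortar d i j).ι,
    ∫ x in ((M.mortar d i j).cell τ).closedInterior,
      P.γ d i j * (P.Kν d i j x)⁻¹ * l d i j τ * m d i j τ ∂μHE[d]

/-- `(K⁻¹ u, v)_T` for Raviart–Thomas functions `u`, `v` on a simplex `T` of `Ω_i^{d+1}`. -/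
def formCell {d : ℕ} (i : G.I (d + 1)) (t : (M.sub (d + 1) i).ι) (u v : RT (G.dir (d + 1) i)) : ℝ :=
  ∫ x in ((M.sub (d + 1) i).cell t).closedInterior,
    inner ℝ ((P.K (d + 1) i).symm (u.eval x)) (v.eval x) ∂μHE[d + 1]

/-- `a(w, r) = (K⁻¹ (u₀ + R_h λ), v₀ + R_h μ)_Ω + (γ K_ν⁻¹ λ, μ)_Γ`. -/
def a (R : ∀ d : Fin n, M.Ld d →ₗ[ℝ] M.Vd d) (w r : M.W) : ℝ :=
  (∑ d : Fin n, ∑ i : G.I (d + 1), ∑ t : (M.sub (d + 1) i).ι,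
    formCell P i t (total R w d i t) (total R r d i t)) + formΓ P w.2 r.2

/-- `a^D(w, r)`: as `a`, with `(K⁻¹ u, v)_T` replaced by its diagonal part
`∑_f (u · ν_f) (v · ν_f) (K⁻¹ φ_f, φ_f)_T`. -/
def aD (R : ∀ d : Fin n, M.Ld d →ₗ[ℝ] M.Vd d) (w r : M.W) : ℝ :=
  (∑ d : Fin n, ∑ i : G.I (d + 1), ∑ t : (M.sub (d + 1) i).ι, ∑ k : Fin ((d : ℕ) + 2),
    flux (total R w d) i t k * flux (total R r d) i t k *
      formCell P i t (RT.basis (G.dir (d + 1) i) ((M.sub (d + 1) i).cell t) k)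
        (RT.basis (G.dir (d + 1) i) ((M.sub (d + 1) i).cell t) k)) + formΓ P w.2 r.2

/-- The jump `⟦μ⟧` on `Ω_i^d`, namely `- ∑_j μ_{ij}`. -/
def jump {d : ℕ} (m : M.Ld d) (i : G.I d) (x : Space n) : ℝ :=
  -∑ j : G.J d i, (M.mortar d i j).toFun (m i j) x

/-- `b(r, q) = -(q, ∇ · (v₀ + R_h μ) + ⟦μ⟧)_Ω`. -/
def b (R : ∀ d : Fin n, M.Ld d →ₗ[ℝ] M.Vd d) (r : M.W) (q : M.Q) : ℝ :=
  -((∑ d : Fin n, ∑ i : G.I (d + 1), ∑ t : (M.sub (d + 1) i).ι,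
      ∫ _x in ((M.sub (d + 1) i).cell t).closedInterior,
        q ⟨d + 1, by omega⟩ i t * (total R r d i t).div d ∂μHE[(d : ℕ) + 1]) +
    ∑ d : Fin n, ∑ i : G.I d,
      ∫ x in G.dom d i,
        (M.sub d i).toFun (q ⟨d, by omega⟩ i) x * jump (r.2 d) i x ∂μHE[d])

/-- `‖r‖_a`. -/
def normA (R : ∀ d : Fin n, M.Ld d →ₗ[ℝ] M.Vd d) (r : M.W) : ℝ := √(a P R r r)

/-- `‖r‖_{a^D}`. -/
def normAD (R : ∀ d : Fin n, M.Ld d →ₗ[ℝ] M.Vd d) (r : M.W) : ℝ := √(aD P R r r)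

/-- `D_h : Q_h → W_h` is the discrete gradient: `a^D(D_h q, r) = b(r, q)` for all `r ∈ W_h`. -/
def IsDiscreteGradient (R : ∀ d : Fin n, M.Ld d →ₗ[ℝ] M.Vd d) (D : M.Q →ₗ[ℝ] M.W) : Prop :=
  ∀ q r, aD P R (D q) r = b R r q

end Mesh

end MixedDim

end

/-!
A Raviart–Thomas function on a `d`-simplex `T` is the combination of the `d + 1` facet basis
functions `φ_f` whose coefficients are its fluxes: `φ_f` is dual to the fluxes because the edge
vectors of the opposite facet are orthogonal to the altitude. Cauchy–Schwarz for the positive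
semidefinite form `(K⁻¹ ·, ·)_T` then gives
`(K⁻¹ u, u)_T ≤ (d + 1) ∑_f (u · ν_f)² (K⁻¹ φ_f, φ_f)_T`, a bound whose constant involves neither
the shape of `T` nor `K`. Summing over all simplices,
`a(r, r) ≤ (n + 1) a^D(r, r)`, and `n + 1 ≤ 4`.

Since `a` is definite, so is `a^D`, and `D_h` is given by duality on the finite-dimensional `W_h`.
Testing the inf-sup quotient with `r = D_h q` leaves `‖D_h q‖_{a^D} / ‖D_h q‖_a`.

The facets on an interface lie neither inside a subdomain nor on the boundary of `Ω`, so that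
`V_h` does not constrain the fluxes through them. The projection onto the normal traces of `V_h` is
therefore the mean over each facet, and prescribing these fluxes defines `R_h`.
-/

noncomputable section

namespace MixedDim

/-! ### Hausdorff measure on affine subspaces -/

section AffineSubspace

variable {V P : Type*} [NormedAddCommGroup V] [InnerProductSpace ℝ V] [MetricSpace P]
  [NormedAddTorsor V P] {A : AffineSubspace ℝ P}

theorem exists_isometry_direction_range_eq (hA : (A : Set P).Nonempty) :
    ∃ φ : A.direction → P, Isometry φ ∧ Set.range φ = A := by
  obtain ⟨p, hp⟩ := hA
  refine ⟨fun v => (v : V) +ᵥ p,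
    (IsometryEquiv.vaddConst p).isometry.comp isometry_subtype_coe,
    Set.ext fun x => ⟨?_, fun hx => ?_⟩⟩
  · rintro ⟨v, rfl⟩
    exact AffineSubspace.vadd_mem_of_mem_direction v.2 hp
  · exact ⟨⟨x -ᵥ p, AffineSubspace.vsub_mem_direction hx hp⟩, vsub_vadd x p⟩

variable [FiniteDimensional ℝ A.direction] [MeasurableSpace P] [BorelSpace P] {d : ℕ}

theorem euclideanHausdorffMeasure_lt_top_of_isBounded (hA : finrank ℝ A.direction = d) {B : Set P}
    (hBA : B ⊆ A) (hB : Bornology.IsBounded B) : μHE[d] B < ⊤ := by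
  subst hA
  rcases B.eq_empty_or_nonempty with rfl | hne
  · simp
  borelize ↥A.direction
  obtain ⟨φ, hφ, hr⟩ := exists_isometry_direction_range_eq (hne.mono hBA)
  rw [← Set.image_preimage_eq_of_subset (hr ▸ hBA : B ⊆ Set.range φ),
    hφ.euclideanHausdorffMeasure_image]
  exact (hφ.antilipschitz.isBounded_preimage hB).measure_lt_top

theorem euclideanHausdorffMeasure_inter_pos_of_isOpen (hA : finrank ℝ A.direction = d) {U : Set P}
    (hU : IsOpen U) (hne : (U ∩ A).Nonempty) : 0 < μHE[d] (U ∩ A) := by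
  subst hA
  borelize ↥A.direction
  obtain ⟨φ, hφ, hr⟩ := exists_isometry_direction_range_eq (hne.mono Set.inter_subset_right)
  rw [← hr] at hne ⊢
  rw [← Set.image_preimage_eq_inter_range, hφ.euclideanHausdorffMeasure_image]
  obtain ⟨_, hx, y, rfl⟩ := hne
  exact (hU.preimage hφ.continuous).measure_pos _ ⟨y, hx⟩

end AffineSubspace

/-! ### Open simplices -/

section AffineSimplex

theorem finrank_direction_affineSpan_range_points {k V P : Type*} [DivisionRing k] [AddCommGroup V]
    [Module k V] [AddTorsor V P] {d : ℕ} (t : Affine.Simplex k P d) :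
    finrank k (affineSpan k (Set.range t.points)).direction = d := by
  rw [direction_affineSpan]
  exact t.independent.finrank_vectorSpan (Fintype.card_fin _)

theorem exists_reindex_eq_of_range_points_eq {k V P : Type*} [Ring k] [Nontrivial k]
    [AddCommGroup V] [Module k V] [AddTorsor V P] {d : ℕ} {t t' : Affine.Simplex k P d}
    (h : Set.range t.points = Set.range t'.points) : ∃ e, t.reindex e = t' := by
  let e := (Equiv.ofInjective _ t.independent.injective).trans
    ((Equiv.setCongr h).trans (Equiv.ofInjective _ t'.independent.injective).symm)
  refine ⟨e, Affine.Simplex.ext fun l => ?_⟩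
  obtain ⟨m, rfl⟩ := e.surjective l
  have hpoints : t'.points (e m) = t.points m :=
    Equiv.apply_ofInjective_symm t'.independent.injective _
  rw [Affine.Simplex.reindex_points, Function.comp_apply, Equiv.symm_apply_apply, hpoints]

theorem isOpen_setInterior_Ioi_of_affineSpan_eq_top {V P : Type*} [NormedAddCommGroup V]
    [NormedSpace ℝ V] [FiniteDimensional ℝ V] [MetricSpace P] [NormedAddTorsor V P] {d : ℕ}
    (s : Affine.Simplex ℝ P d) (hs : affineSpan ℝ (Set.range s.points) = ⊤) (a : ℝ) :
    IsOpen (s.setInterior (Set.Ioi a)) := by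
  let b : AffineBasis (Fin (d + 1)) ℝ P := ⟨s.points, s.independent, hs⟩
  have heq : s.setInterior (Set.Ioi a) = ⋂ k, b.coord k ⁻¹' Set.Ioi a := by
    ext x
    rw [Set.mem_iInter]
    nth_rewrite 1 [← b.affineCombination_coord_eq_self x]
    exact Affine.Simplex.affineCombination_mem_setInterior_iff (b.sum_coord_apply_eq_one x)
  rw [heq]
  exact isOpen_iInter_of_finite fun k => isOpen_Ioi.preimage (continuous_barycentric_coord b k)

end AffineSimplex

section OpenCell

variable {n d : ℕ} (t : Affine.Simplex ℝ (Space n) d)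

theorem openCell_subset_affineSpan :
    openCell t ⊆ affineSpan ℝ (Set.range t.points) :=
  t.setInterior_subset_affineSpan

theorem openCell_subset_closedInterior : openCell t ⊆ t.closedInterior := by
  rintro x ⟨w, hw, hpos, rfl⟩
  refine ⟨w, hw, fun k => ⟨(hpos k).le, ?_⟩, rfl⟩
  rw [← hw]
  exact Finset.single_le_sum (fun l _ => (hpos l).le) (Finset.mem_univ k)

theorem centroid_mem_openCell : t.centroid ∈ openCell t := by
  refine (Affine.Simplex.affineCombination_mem_setInterior_iff
    (Finset.univ.sum_centroidWeights_eq_one_of_nonempty ℝ Finset.univ_nonempty)).2 fun k => ?_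
  simp only [Finset.centroidWeights_apply, Finset.card_univ, Fintype.card_fin, Set.mem_Ioi]
  positivity

variable {t} in
theorem openCell_eq_of_range_points_eq {t' : Affine.Simplex ℝ (Space n) d}
    (h : Set.range t.points = Set.range t'.points) : openCell t = openCell t' := by
  obtain ⟨e, rfl⟩ := exists_reindex_eq_of_range_points_eq h
  exact (t.setInterior_reindex (Set.Ioi 0) e).symm

theorem exists_isOpen_inter_affineSpan_eq_openCell :
    ∃ U : Set (Space n), IsOpen U ∧
      U ∩ (affineSpan ℝ (Set.range t.points) : Set (Space n)) = openCell t := by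
  set A := affineSpan ℝ (Set.range t.points)
  have : Nonempty A := Nonempty.map (AffineSubspace.inclusion le_rfl) inferInstance
  have hspan : affineSpan ℝ (Set.range (t.restrict A le_rfl).points) = ⊤ := by
    rw [(t.restrict A le_rfl).independent.affineSpan_eq_top_iff_card_eq_finrank_add_one]
    simpa using (finrank_direction_affineSpan_range_points t).symm
  have hopen := isOpen_setInterior_Ioi_of_affineSpan_eq_top _ hspan 0
  rw [t.setInterior_restrict (Set.Ioi 0) le_rfl, isOpen_induced_iff] at hopen
  obtain ⟨U, hU, hUA⟩ := hopen
  refine ⟨U, hU, ?_⟩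
  calc U ∩ (A : Set (Space n))
      = Subtype.val '' (Subtype.val ⁻¹' U : Set A) :=
        (Set.inter_comm _ _).trans (Subtype.image_preimage_coe _ _).symm
    _ = Subtype.val '' (Subtype.val ⁻¹' openCell t : Set A) := congrArg _ hUA
    _ = (A : Set (Space n)) ∩ openCell t := Subtype.image_preimage_coe _ _
    _ = openCell t := Set.inter_eq_right.2 (openCell_subset_affineSpan t)

theorem measurableSet_openCell : MeasurableSet (openCell t) := by
  obtain ⟨U, hU, h⟩ := exists_isOpen_inter_affineSpan_eq_openCell t
  rw [← h]
  exact hU.measurableSet.inter (AffineSubspace.closed_of_finiteDimensional _).measurableSet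

theorem euclideanHausdorffMeasure_inter_openCell_pos {V : Set (Space n)} (hV : IsOpen V)
    (hne : (V ∩ openCell t).Nonempty) : 0 < μHE[d] (V ∩ openCell t) := by
  obtain ⟨U, hU, h⟩ := exists_isOpen_inter_affineSpan_eq_openCell t
  rw [← h, ← Set.inter_assoc] at hne ⊢
  exact euclideanHausdorffMeasure_inter_pos_of_isOpen
    (finrank_direction_affineSpan_range_points t) (hV.inter hU) hne

theorem euclideanHausdorffMeasure_openCell_pos : 0 < μHE[d] (openCell t) := by
  simpa using euclideanHausdorffMeasure_inter_openCell_pos t isOpen_univ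
    ⟨_, Set.mem_univ _, centroid_mem_openCell t⟩

theorem openCell_nontrivial (hd : d ≠ 0) : (openCell t).Nontrivial := by
  by_contra h
  have hpos := euclideanHausdorffMeasure_openCell_pos t
  have : (μH[d] : Measure (Space n)) (openCell t) = 0 := by
    have := Measure.nullSingletonClass_hausdorff (Space n) (d := d) (by positivity)
    exact (Set.not_nontrivial_iff.1 h).measure_zero _
  simp [Measure.euclideanHausdorffMeasure_def, this] at hpos

theorem euclideanHausdorffMeasure_closedInterior_pos : 0 < μHE[d] t.closedInterior :=
  (euclideanHausdorffMeasure_openCell_pos t).trans_le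
    (measure_mono (openCell_subset_closedInterior t))

instance isFiniteMeasure_restrict_closedInterior :
    IsFiniteMeasure ((μHE[d] : Measure (Space n)).restrict t.closedInterior) :=
  isFiniteMeasure_restrict.2 (euclideanHausdorffMeasure_lt_top_of_isBounded
    (finrank_direction_affineSpan_range_points t) t.closedInterior_subset_affineSpan
    t.isCompact_closedInterior.isBounded).ne

theorem measurableSet_closedInterior : MeasurableSet t.closedInterior :=
  t.isClosed_closedInterior.measurableSet

theorem integrableOn_closedInterior_of_continuous {F : Type*} [NormedAddCommGroup F]
    {f : Space n → F} (hf : Continuous f) :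
    IntegrableOn f t.closedInterior μHE[d] :=
  hf.continuousOn.integrableOn_of_subset_isCompact t.isCompact_closedInterior
    (measurableSet_closedInterior t) subset_rfl
    (isFiniteMeasure_restrict.1 (isFiniteMeasure_restrict_closedInterior t))

theorem eq_zero_on_openCell_of_setIntegral_eq_zero {f : Space n → ℝ} (hf : Continuous f)
    (hnonneg : ∀ x, 0 ≤ f x) (h0 : ∫ x in t.closedInterior, f x ∂μHE[d] = 0) :
    ∀ x ∈ openCell t, f x = 0 := by
  have hae := (setIntegral_eq_zero_iff_of_nonneg_ae (.of_forall hnonneg)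
    (integrableOn_closedInterior_of_continuous t hf)).1 h0
  rw [Filter.EventuallyEq, ae_restrict_iff' (measurableSet_closedInterior t), ae_iff] at hae
  have hnull : μHE[d] ({x | f x ≠ 0} ∩ openCell t) = 0 := by
    refine measure_mono_null ?_ hae
    exact fun x hx hcon => hx.1 (hcon (openCell_subset_closedInterior t hx.2))
  intro x hx
  by_contra hne
  exact (euclideanHausdorffMeasure_inter_openCell_pos t (isOpen_ne_fun hf continuous_const)
    ⟨x, hne, hx⟩).ne' hnull

end OpenCell

/-! ### The degrees of freedom of a Raviart–Thomas function -/

namespace RT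

variable {n d : ℕ} {S : Submodule ℝ (Space n)}

theorem eval_add (v w : RT S) (x : Space n) : (v + w).eval x = v.eval x + w.eval x := by
  simp only [eval, Prod.fst_add, Prod.snd_add, add_smul]
  abel

theorem eval_smul (c : ℝ) (v : RT S) (x : Space n) : (c • v).eval x = c • v.eval x := by
  simp only [eval, Prod.smul_fst, Prod.smul_snd, smul_assoc, smul_add]

theorem continuous_eval (v : RT S) : Continuous v.eval := by
  unfold eval
  fun_prop

theorem coe_eval_sub_eval (v : RT S) {x y : Space n} (hxy : x - y ∈ S) :
    (v.eval x - v.eval y : Space n) = v.2 • (x - y) := by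
  have hP : (S.orthogonalProjectionOnto (x - y) : Space n) = x - y :=
    congrArg Subtype.val (S.orthogonalProjectionOnto_mem_subspace_eq_self ⟨_, hxy⟩)
  rw [← Submodule.coe_sub, eval, eval, add_sub_add_left_eq_sub, ← smul_sub, ← map_sub,
    Submodule.coe_smul, hP]

/-- The normal components on the facets of a simplex, the degrees of freedom of the
Raviart–Thomas space. -/
def fluxMap (t : Affine.Simplex ℝ (Space n) (d + 1)) : RT S →ₗ[ℝ] (Fin (d + 2) → ℝ) where
  toFun v k := v.flux t k
  map_add' v w := by
    ext k
    simp only [flux, eval_add, Submodule.coe_add, inner_add_left, Pi.add_apply]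
  map_smul' c v := by
    ext k
    simp only [flux, eval_smul, Submodule.coe_smul, real_inner_smul_left, RingHom.id_apply,
      Pi.smul_apply, smul_eq_mul]

theorem fluxMap_apply (t : Affine.Simplex ℝ (Space n) (d + 1)) (v : RT S) (k : Fin (d + 2)) :
    fluxMap t v k = v.flux t k := rfl

variable (t : Affine.Simplex ℝ (Space n) (d + 1))
  (hS : (affineSpan ℝ (Set.range t.points)).direction = S)

include hS

theorem sub_mem_of_mem_affineSpan {x y : Space n} (hx : x ∈ affineSpan ℝ (Set.range t.points))
    (hy : y ∈ affineSpan ℝ (Set.range t.points)) : x - y ∈ S :=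
  hS ▸ AffineSubspace.vsub_mem_direction hx hy

theorem coe_eval_basis (k : Fin (d + 2)) {x : Space n}
    (hx : x ∈ affineSpan ℝ (Set.range t.points)) :
    ((basis S t k).eval x : Space n) = (t.height k)⁻¹ • (x - t.points k) := by
  have hvertex : (basis S t k).eval (t.points k) = 0 := neg_add_cancel _
  have h := coe_eval_sub_eval (basis S t k) (sub_mem_of_mem_affineSpan t hS hx
    (mem_affineSpan ℝ (Set.mem_range_self k)))
  rwa [hvertex, Submodule.coe_zero, sub_zero] at h

theorem flux_basis (k l : Fin (d + 2)) : (basis S t k).flux t l = if l = k then 1 else 0 := by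
  rw [flux, coe_eval_basis t hS k (t.altitudeFoot_mem_affineSpan l), outerNormal,
    real_inner_smul_left, real_inner_smul_right]
  split_ifs with h
  · subst h
    have hheight : ‖t.altitudeFoot l - t.points l‖ = t.height l := by
      rw [Affine.Simplex.height, dist_comm, dist_eq_norm]
    have hne := (t.height_pos l).ne'
    rw [real_inner_self_eq_norm_sq, hheight]
    field_simp
  · have horth := t.inner_vsub_altitudeFoot_vsub_altitudeFoot_eq_zero h
    simp only [vsub_eq_sub] at horth
    rw [← neg_sub (t.points k), ← neg_sub (t.points l), inner_neg_neg, horth,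
      mul_zero, mul_zero]

theorem flux_sum_smul_basis (c : Fin (d + 2) → ℝ) (l : Fin (d + 2)) :
    (∑ k, c k • basis S t k).flux t l = c l := by
  simp only [← fluxMap_apply, map_sum, map_smul, Finset.sum_apply, Pi.smul_apply]
  simp only [fluxMap_apply, flux_basis t hS, smul_eq_mul, mul_ite, mul_one, mul_zero,
    Finset.sum_ite_eq, Finset.mem_univ, if_true]

theorem fluxMap_injective : Function.Injective (fluxMap (S := S) t) := by
  have hdim : finrank ℝ (RT S) = finrank ℝ (Fin (d + 2) → ℝ) := by
    have hfinrank := finrank_direction_affineSpan_range_points t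
    rw [hS] at hfinrank
    simp [Module.finrank_prod, hfinrank]
  exact (LinearMap.injective_iff_surjective_of_finrank_eq_finrank hdim).2 fun c =>
    ⟨∑ k, c k • basis S t k, funext (flux_sum_smul_basis t hS c)⟩

theorem sum_flux_smul_basis (v : RT S) : ∑ k, v.flux t k • basis S t k = v :=
  fluxMap_injective t hS (funext (flux_sum_smul_basis t hS _))

theorem eq_zero_of_eval_eq_zero {v : RT S} (hv : ∀ x ∈ openCell t, v.eval x = 0) : v = 0 := by
  obtain ⟨x, hx, y, hy, hxy⟩ := openCell_nontrivial t d.succ_ne_zero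
  have hslope : v.2 • (x - y) = 0 := by
    rw [← coe_eval_sub_eval v (sub_mem_of_mem_affineSpan t hS (openCell_subset_affineSpan t hx)
      (openCell_subset_affineSpan t hy)), hv x hx, hv y hy, sub_self]
  have hv2 : v.2 = 0 := (smul_eq_zero.1 hslope).resolve_right (sub_ne_zero.2 hxy)
  exact Prod.ext (by simpa [eval, hv2] using hv x hx) hv2

end RT

/-! ### Semidefinite and nondegenerate forms -/

section BilinForm

open LinearMap (BilinForm)

theorem apply_sum_self_le_card_mul_sum {A E ι : Type*} [CommRing A] [LinearOrder A]
    [IsStrictOrderedRing A] [AddCommGroup E] [Module A E] {B : BilinForm A E} (hB : B.IsNonneg)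
    (s : Finset ι) (x : ι → E) :
    B (∑ k ∈ s, x k) (∑ k ∈ s, x k) ≤ s.card * ∑ k ∈ s, B (x k) (x k) := by
  -- Expand the sum of `B (x k - x l) (x k - x l)` over all pairs.
  have hnonneg : 0 ≤ ∑ k ∈ s, ∑ l ∈ s, B (x k - x l) (x k - x l) :=
    Finset.sum_nonneg fun k _ => Finset.sum_nonneg fun l _ => hB.nonneg _
  have hsum : B (∑ k ∈ s, x k) (∑ k ∈ s, x k) = ∑ k ∈ s, ∑ l ∈ s, B (x k) (x l) := by
    simp only [map_sum, LinearMap.coe_sum, Finset.sum_apply]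
    exact Finset.sum_comm
  have hexpand : ∑ k ∈ s, ∑ l ∈ s, B (x k - x l) (x k - x l) =
      2 * (s.card * ∑ k ∈ s, B (x k) (x k)) - 2 * ∑ k ∈ s, ∑ l ∈ s, B (x k) (x l) := by
    simp only [map_sub, LinearMap.sub_apply, Finset.sum_sub_distrib, Finset.sum_const,
      nsmul_eq_mul, ← Finset.mul_sum]
    rw [Finset.sum_comm (f := fun k l => B (x l) (x k))]
    ring
  linarith

theorem existsUnique_linearMap_apply_eq {k E F : Type*} [Field k] [AddCommGroup E] [Module k E]
    [FiniteDimensional k E] [AddCommGroup F] [Module k F] {B : BilinForm k E}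
    (hB : B.Nondegenerate) (b : F →ₗ[k] Dual k E) :
    ∃! D : F →ₗ[k] E, ∀ q r, B (D q) r = b q r := by
  refine ⟨(B.toDual hB).symm ∘ₗ b,
    fun q r => LinearMap.BilinForm.apply_toDual_symm_apply (hB := hB) (b q) r, fun D hD => ?_⟩
  ext1 q
  exact (B.toDual hB).eq_symm_apply.2 (LinearMap.ext (hD q))

theorem nondegenerate_of_anisotropic {k E : Type*} [Field k] [AddCommGroup E] [Module k E]
    {B : BilinForm k E} (hB : ∀ x, B x x = 0 → x = 0) : B.Nondegenerate :=
  ⟨fun x hx => hB x (hx x), fun x hx => hB x (hx x)⟩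

end BilinForm

/-! ### Meshes -/

namespace Triangulation

variable {n d : ℕ} {S : Set (Space n)} (T : Triangulation d S)

theorem closedInterior_cell_subset (τ : T.ι) : (T.cell τ).closedInterior ⊆ closure S :=
  T.iUnion_cell ▸ Set.subset_iUnion (fun τ => (T.cell τ).closedInterior) τ

include T in
theorem isBounded : Bornology.IsBounded S :=
  (Bornology.isBounded_iUnion.2 fun τ =>
    (T.cell τ).isCompact_closedInterior.isBounded).subset (T.iUnion_cell ▸ subset_closure)

theorem toFun_add (c c' : T.ι → ℝ) (x : Space n) :
    T.toFun (c + c') x = T.toFun c x + T.toFun c' x := by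
  simp only [toFun, ← Finset.sum_add_distrib, Pi.add_apply, Set.indicator_add]

theorem toFun_smul (a : ℝ) (c : T.ι → ℝ) (x : Space n) :
    T.toFun (a • c) x = a * T.toFun c x := by
  simp only [toFun, Finset.mul_sum, Pi.smul_apply, smul_eq_mul, Set.indicator_const_mul]

theorem measurable_toFun (c : T.ι → ℝ) : Measurable (T.toFun c) :=
  Finset.measurable_fun_sum _ fun τ _ =>
    measurable_const.indicator (measurableSet_openCell (T.cell τ))

theorem norm_toFun_le (c : T.ι → ℝ) (x : Space n) : ‖T.toFun c x‖ ≤ ∑ τ, ‖c τ‖ :=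
  (norm_sum_le _ _).trans (Finset.sum_le_sum fun _ _ => norm_indicator_le_norm_self _ _)

theorem integrable_toFun (c : T.ι → ℝ) (m : Measure (Space n)) [IsFiniteMeasure m] :
    Integrable (T.toFun c) m :=
  .of_bound (T.measurable_toFun c).aestronglyMeasurable _ (.of_forall (T.norm_toFun_le c))

end Triangulation

theorem Decomposition.dom_subset_aff {n : ℕ} (G : Decomposition n) (d : ℕ) (i : G.I d) :
    G.dom d i ⊆ G.aff d i := by
  obtain ⟨U, -, h⟩ := G.dom_relOpen d i
  exact h ▸ Set.inter_subset_right

section Subdomain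

variable {n : ℕ} {G : Decomposition n} {d : ℕ} {i : G.I d} (T : Triangulation d (G.dom d i))

theorem Triangulation.direction_cell (τ : T.ι) :
    (affineSpan ℝ (Set.range (T.cell τ).points)).direction = G.dir d i := by
  have hle : affineSpan ℝ (Set.range (T.cell τ).points) ≤ G.aff d i := by
    rw [affineSpan_le]
    rintro _ ⟨k, rfl⟩
    exact closure_minimal (G.dom_subset_aff d i) (AffineSubspace.closed_of_finiteDimensional _)
      (T.closedInterior_cell_subset τ ((T.cell τ).point_mem_closedInterior k))
  exact Submodule.eq_of_le_of_finrank_eq (AffineSubspace.direction_le hle)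
    ((finrank_direction_affineSpan_range_points _).trans (G.finrank_aff d i).symm)

include T in
theorem Triangulation.isFiniteMeasure_restrict_dom :
    IsFiniteMeasure ((μHE[d] : Measure (Space n)).restrict (G.dom d i)) :=
  isFiniteMeasure_restrict.2 (euclideanHausdorffMeasure_lt_top_of_isBounded (G.finrank_aff d i)
    (G.dom_subset_aff d i) T.isBounded).ne

end Subdomain

/-! ### The form `(K⁻¹ u, v)_T` on one simplex -/

namespace Params

variable {n d : ℕ} {G : Geometry n} (P : Params G) {i : G.I d}

theorem inner_symm_left (u v : G.dir d i) :
    inner ℝ ((P.K d i).symm u) v = inner ℝ u ((P.K d i).symm v) := by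
  simpa using (P.K_symm d i ((P.K d i).symm u) ((P.K d i).symm v)).symm

theorem inner_symm_self_pos {u : G.dir d i} (hu : u ≠ 0) : 0 < inner ℝ ((P.K d i).symm u) u := by
  simpa [real_inner_comm] using P.K_pos d i ((P.K d i).symm u) (by simpa using hu)

theorem inner_symm_self_nonneg (u : G.dir d i) : 0 ≤ inner ℝ ((P.K d i).symm u) u := by
  rcases eq_or_ne u 0 with rfl | hu
  · simp
  · exact (P.inner_symm_self_pos hu).le

end Params

namespace Mesh

variable {n : ℕ} {G : Geometry n} {M : Mesh G} (P : Params G)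

section Cell

variable {d : ℕ} (i : G.I (d + 1)) (t : (M.sub (d + 1) i).ι)

theorem continuous_inner_symm_eval (u v : RT (G.dir (d + 1) i)) :
    Continuous fun x => inner ℝ ((P.K (d + 1) i).symm (u.eval x)) (v.eval x) :=
  ((LinearMap.continuous_of_finiteDimensional
    (P.K (d + 1) i).symm.toLinearMap).comp u.continuous_eval).inner v.continuous_eval

theorem formCell_comm (u v : RT (G.dir (d + 1) i)) :
    formCell P i t u v = formCell P i t v u :=
  integral_congr_ae (.of_forall fun _ => (P.inner_symm_left _ _).trans (real_inner_comm _ _))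

theorem formCell_add_left (u u' v : RT (G.dir (d + 1) i)) :
    formCell P i t (u + u') v = formCell P i t u v + formCell P i t u' v := by
  have hint u := integrableOn_closedInterior_of_continuous ((M.sub (d + 1) i).cell t)
    (continuous_inner_symm_eval P i u v)
  simp only [formCell, RT.eval_add, map_add, inner_add_left]
  exact integral_add (hint u) (hint u')

theorem formCell_smul_left (c : ℝ) (u v : RT (G.dir (d + 1) i)) :
    formCell P i t (c • u) v = c * formCell P i t u v := by
  simp only [formCell, RT.eval_smul, map_smul, Submodule.coe_inner, Submodule.coe_smul,
    real_inner_smul_left, integral_const_mul]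

/-- `formCell` as a bilinear form. -/
def formCellMap : LinearMap.BilinForm ℝ (RT (G.dir (d + 1) i)) :=
  .mk₂ ℝ (formCell P i t) (formCell_add_left P i t) (formCell_smul_left P i t)
    (fun u v v' => by simp only [formCell_comm P i t u, formCell_add_left])
    (fun c u v => by simp only [formCell_comm P i t u, formCell_smul_left, smul_eq_mul])

theorem formCellMap_apply (u v : RT (G.dir (d + 1) i)) :
    formCellMap P i t u v = formCell P i t u v := rfl

theorem formCell_self_nonneg (u : RT (G.dir (d + 1) i)) : 0 ≤ formCell P i t u u :=
  integral_nonneg fun _ => P.inner_symm_self_nonneg _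

theorem eq_zero_of_formCell_self_eq_zero {u : RT (G.dir (d + 1) i)}
    (h : formCell P i t u u = 0) : u = 0 := by
  refine RT.eq_zero_of_eval_eq_zero _ ((M.sub (d + 1) i).direction_cell t) fun x hx => ?_
  by_contra hne
  exact (P.inner_symm_self_pos hne).ne' (eq_zero_on_openCell_of_setIntegral_eq_zero _
    (continuous_inner_symm_eval P i u u) (fun _ => P.inner_symm_self_nonneg _) h x hx)

/-- The diagonal part `∑_f (u · ν_f) (v · ν_f) (K⁻¹ φ_f, φ_f)_T` of `(K⁻¹ u, v)_T`. -/
def formCellDiag (u v : RT (G.dir (d + 1) i)) : ℝ :=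
  ∑ k, u.flux ((M.sub (d + 1) i).cell t) k * v.flux ((M.sub (d + 1) i).cell t) k *
    formCell P i t (RT.basis _ ((M.sub (d + 1) i).cell t) k)
      (RT.basis _ ((M.sub (d + 1) i).cell t) k)

theorem formCellDiag_self_nonneg (u : RT (G.dir (d + 1) i)) : 0 ≤ formCellDiag P i t u u :=
  Finset.sum_nonneg fun _ _ => mul_nonneg (mul_self_nonneg _) (formCell_self_nonneg P i t _)

theorem formCell_self_le (u : RT (G.dir (d + 1) i)) :
    formCell P i t u u ≤ (d + 2) * formCellDiag P i t u u := by
  have h := apply_sum_self_le_card_mul_sum (B := formCellMap P i t)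
    ⟨formCell_self_nonneg P i t⟩ Finset.univ fun k =>
      u.flux ((M.sub (d + 1) i).cell t) k • RT.basis _ ((M.sub (d + 1) i).cell t) k
  rw [RT.sum_flux_smul_basis _ ((M.sub (d + 1) i).direction_cell t)] at h
  simpa only [formCellDiag, formCellMap_apply, map_smul, LinearMap.smul_apply, smul_eq_mul,
    Finset.card_univ, Fintype.card_fin, Nat.cast_add, Nat.cast_ofNat, mul_assoc] using h

end Cell

/-! ### The interface form -/

section Interface

variable {d : ℕ} (i : G.I d) (j : G.J d i) (τ : (M.mortar d i j).ι)

/-- The weight `∫_τ γ K_ν⁻¹` of a mortar cell `τ` in the interface form. -/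
def mortarWeight : ℝ :=
  ∫ x in ((M.mortar d i j).cell τ).closedInterior, P.γ d i j * (P.Kν d i j x)⁻¹ ∂μHE[d]

theorem integrableOn_closedInterior_inv_Kν :
    IntegrableOn (fun x => P.γ d i j * (P.Kν d i j x)⁻¹)
      ((M.mortar d i j).cell τ).closedInterior μHE[d] := by
  obtain ⟨m, _, hm, hK⟩ := P.Kν_bounds d i j
  refine (Integrable.of_bound (P.Kν_measurable d i j).inv.aestronglyMeasurable m⁻¹
    ((ae_restrict_iff' (measurableSet_closedInterior _)).2 (.of_forall fun x hx => ?_))).const_mul _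
  have hmK := (hK x ((M.mortar d i j).closedInterior_cell_subset τ hx)).1
  rw [Pi.inv_apply, norm_inv, Real.norm_of_nonneg (hm.le.trans hmK)]
  exact inv_anti₀ hm hmK

theorem mortarWeight_pos : 0 < mortarWeight P i j τ := by
  obtain ⟨m, _, hm, hK⟩ := P.Kν_bounds d i j
  have hpos : ∀ x ∈ ((M.mortar d i j).cell τ).closedInterior,
      0 < P.γ d i j * (P.Kν d i j x)⁻¹ := fun x hx =>
    mul_pos (P.γ_pos d i j) (inv_pos.2 (hm.trans_le
      (hK x ((M.mortar d i j).closedInterior_cell_subset τ hx)).1))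
  rw [mortarWeight, setIntegral_pos_iff_support_of_nonneg_ae
    ((ae_restrict_iff' (measurableSet_closedInterior _)).2
      (.of_forall fun x hx => (hpos x hx).le))
    (integrableOn_closedInterior_inv_Kν P i j τ)]
  exact (euclideanHausdorffMeasure_closedInterior_pos _).trans_le
    (measure_mono fun x hx => ⟨(hpos x hx).ne', hx⟩)

end Interface

theorem formΓ_eq_sum_mortarWeight (l m : M.L) :
    formΓ P l m = ∑ d : Fin n, ∑ i : G.I d, ∑ j : G.J d i, ∑ τ : (M.mortar d i j).ι,
      mortarWeight P i j τ * (l d i j τ * m d i j τ) := by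
  simp only [formΓ, mortarWeight, ← integral_mul_const, mul_assoc]

theorem formΓ_self_nonneg (m : M.L) : 0 ≤ formΓ P m m := by
  rw [formΓ_eq_sum_mortarWeight]
  exact Finset.sum_nonneg fun d _ => Finset.sum_nonneg fun i _ => Finset.sum_nonneg fun j _ =>
    Finset.sum_nonneg fun τ _ => mul_nonneg (mortarWeight_pos P i j τ).le (mul_self_nonneg _)

theorem eq_zero_of_formΓ_self_eq_zero {m : M.L} (h : formΓ P m m = 0) : m = 0 := by
  have hnonneg (d : Fin n) (i : G.I d) (j : G.J d i) (τ : (M.mortar d i j).ι) :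
      0 ≤ mortarWeight P i j τ * (m d i j τ * m d i j τ) :=
    mul_nonneg (mortarWeight_pos P i j τ).le (mul_self_nonneg _)
  rw [formΓ_eq_sum_mortarWeight, ← Fintype.sum_sigma', ← Fintype.sum_sigma',
    ← Fintype.sum_sigma', Fintype.sum_eq_zero_iff_of_nonneg fun _ => hnonneg _ _ _ _] at h
  funext d i j τ
  have hprod := congrFun h ⟨⟨⟨d, i⟩, j⟩, τ⟩
  exact mul_self_eq_zero.1 ((mul_eq_zero.1 hprod).resolve_left (mortarWeight_pos P i j τ).ne')

/-! ### Existence of the discrete extension operator -/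

section Extension

variable {d : ℕ}

open Classical in
/-- The mean of `μ` over the facet `(t, k)` if this facet lies on an interface, zero otherwise. The
condition is `OnInterface i j t k`, spelled out for a subdomain `i'` that is only propositionally
equal to `up d i j`. -/
def facetMean (μ : M.Ld d) (i' : G.I (d + 1)) (t : (M.sub (d + 1) i').ι) (k : Fin (d + 2)) : ℝ :=
  ∑ i : G.I d, ∑ j : G.J d i,
    if G.up d i j = i' ∧ openCell (M.fct i' t k) ⊆ G.dom d i ∧
      outerNormal ((M.sub (d + 1) i').cell t) k = G.normal d i j then
      ⨍ x in (M.fct i' t k).closedInterior, (M.mortar d i j).toFun (μ i j) x ∂μHE[d]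
    else 0

variable {i' : G.I (d + 1)} {t : (M.sub (d + 1) i').ι} {k : Fin (d + 2)}

theorem facetMean_add (μ μ' : M.Ld d) :
    facetMean (μ + μ') i' t k = facetMean μ i' t k + facetMean μ' i' t k := by
  simp only [facetMean, ← Finset.sum_add_distrib]
  refine Finset.sum_congr rfl fun i _ => Finset.sum_congr rfl fun j _ => ?_
  split_ifs
  · simp only [setAverage_eq, Pi.add_apply, Triangulation.toFun_add]
    rw [integral_add (Triangulation.integrable_toFun _ _ _)
      (Triangulation.integrable_toFun _ _ _), smul_add]
  · rw [add_zero]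

theorem facetMean_smul (c : ℝ) (μ : M.Ld d) :
    facetMean (c • μ) i' t k = c * facetMean μ i' t k := by
  simp only [facetMean, Finset.mul_sum, mul_ite, mul_zero, setAverage_eq, Pi.smul_apply,
    Triangulation.toFun_smul, smul_eq_mul, integral_const_mul, mul_left_comm]

theorem facetMean_eq_zero (μ : M.Ld d)
    (h : ∀ i : G.I d, ¬ openCell (M.fct i' t k) ⊆ G.dom d i) : facetMean μ i' t k = 0 :=
  Finset.sum_eq_zero fun i _ => Finset.sum_eq_zero fun _ _ => if_neg fun hcond => h i hcond.2.1

theorem facetMean_of_subset_dom (μ : M.Ld d) {i'' : G.I (d + 1)}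
    (h : openCell (M.fct i' t k) ⊆ G.dom (d + 1) i'') : facetMean μ i' t k = 0 := by
  refine facetMean_eq_zero μ fun i hi => ?_
  have hx := centroid_mem_openCell (M.fct i' t k)
  have hne : (⟨d + 1, i''⟩ : Σ d, G.I d) ≠ ⟨d, i⟩ := fun heq =>
    d.succ_ne_self (congrArg Sigma.fst heq)
  exact Set.disjoint_left.1 (G.dom_disjoint hne) (h hx) (hi hx)

theorem facetMean_of_subset_boundary (μ : M.Ld d)
    (h : openCell (M.fct i' t k) ⊆ G.bdD ∪ G.bdN) : facetMean μ i' t k = 0 := by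
  refine facetMean_eq_zero μ fun i hi => ?_
  have hx := centroid_mem_openCell (M.fct i' t k)
  have hfrontier := h hx
  rw [G.bd_union, G.omega_open.frontier_eq] at hfrontier
  exact hfrontier.2 (Set.mem_iUnion₂.2 ⟨d, i, hi hx⟩)

theorem interface_unique {i i₁ : G.I d} {j : G.J d i} {j₁ : G.J d i₁} {x : Space n}
    (hx : x ∈ G.dom d i) (hx₁ : x ∈ G.dom d i₁) (hup : G.up d i₁ j₁ = G.up d i j)
    (hnormal : G.normal d i₁ j₁ = G.normal d i j) :
    (⟨i₁, j₁⟩ : Σ i, G.J d i) = ⟨i, j⟩ := by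
  obtain rfl : i₁ = i := by
    by_contra hne
    have hne' : (⟨d, i₁⟩ : Σ d, G.I d) ≠ ⟨d, i⟩ := fun heq => hne (by simpa using heq)
    exact Set.disjoint_left.1 (G.dom_disjoint hne') hx₁ hx
  rw [(G.side_unique d i₁ x hx _ _ (G.normal_unit d i₁ j) (G.normal_orth d i₁ j)
    (G.normal_side d i₁ j x hx)).unique ⟨hup, hnormal⟩ ⟨rfl, rfl⟩]

theorem facetMean_of_onInterface (μ : M.Ld d) {i : G.I d} {j : G.J d i}
    {t : (M.sub (d + 1) (G.up d i j)).ι} (h : M.OnInterface i j t k) :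
    facetMean μ (G.up d i j) t k =
      ⨍ x in (M.fct (G.up d i j) t k).closedInterior,
        (M.mortar d i j).toFun (μ i j) x ∂μHE[d] := by
  have hx := centroid_mem_openCell (M.fct (G.up d i j) t k)
  rw [facetMean, ← Fintype.sum_sigma', Fintype.sum_eq_single ⟨i, j⟩, if_pos ⟨rfl, h⟩]
  rintro ⟨i₁, j₁⟩ hne
  exact if_neg fun ⟨hup, hsub, hnormal⟩ => hne <|
    interface_unique (h.1 hx) (hsub hx) hup (hnormal.symm.trans h.2)

/-- The piecewise Raviart–Thomas field whose normal component on each facet is `facetMean μ`. -/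
def extensionField (μ : M.Ld d) : M.Xd d := fun i t =>
  ∑ k, facetMean μ i t k • RT.basis (G.dir (d + 1) i) ((M.sub (d + 1) i).cell t) k

theorem flux_extensionField (μ : M.Ld d) (i : G.I (d + 1)) (t : (M.sub (d + 1) i).ι)
    (k : Fin (d + 2)) : flux (extensionField μ) i t k = facetMean μ i t k :=
  RT.flux_sum_smul_basis _ ((M.sub (d + 1) i).direction_cell t) _ k

theorem extensionField_mem_Vd (μ : M.Ld d) : extensionField μ ∈ M.Vd d := by
  refine ⟨fun i t t' k k' _ hpoints hsub => ?_, fun i t k hsub => ?_⟩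
  · have hsub' : openCell (M.fct i t' k') ⊆ G.dom (d + 1) i :=
      openCell_eq_of_range_points_eq hpoints ▸ hsub
    rw [flux_extensionField, flux_extensionField, facetMean_of_subset_dom μ hsub,
      facetMean_of_subset_dom μ hsub', add_zero]
  · rw [flux_extensionField]
    exact facetMean_of_subset_boundary μ (hsub.trans Set.subset_union_right)

variable (M d) in
/-- A discrete extension operator `R_h^d`, obtained by taking means over the facets on the
interfaces. -/
def extension : M.Ld d →ₗ[ℝ] M.Vd d where
  toFun μ := ⟨extensionField μ, extensionField_mem_Vd μ⟩
  map_add' μ μ' := by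
    ext1
    funext i t
    simp only [extensionField, facetMean_add, add_smul, Finset.sum_add_distrib, Submodule.coe_add,
      Pi.add_apply]
  map_smul' c μ := by
    ext1
    funext i t
    simp only [extensionField, facetMean_smul, mul_smul, Finset.smul_sum, Submodule.coe_smul,
      Pi.smul_apply, RingHom.id_apply]

theorem flux_extension (μ : M.Ld d) (i : G.I (d + 1)) (t : (M.sub (d + 1) i).ι)
    (k : Fin (d + 2)) : flux (extension M d μ : M.Xd d) i t k = facetMean μ i t k :=
  flux_extensionField μ i t k

variable (M d) in
theorem isExtension_extension : M.IsExtension d (extension M d) := by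
  refine ⟨fun μ v => ?_, fun μ i t k hsub => ?_⟩
  · refine Finset.sum_eq_zero fun i _ => Finset.sum_eq_zero fun j _ =>
      Finset.sum_eq_zero fun t _ => Finset.sum_eq_zero fun k _ => ?_
    split_ifs with h
    · rw [integral_mul_const, flux_extension, facetMean_of_onInterface μ h,
        integral_average_sub (Triangulation.integrable_toFun _ _ _), zero_mul]
    · rfl
  · rw [flux_extension, facetMean_of_subset_boundary μ hsub]

end Extension

/-! ### The forms `a` and `a^D` -/

section Omega

variable (u v : ∀ d : Fin n, M.Xd d)

/-- `(K⁻¹ u, v)_Ω`. -/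
def formΩ : ℝ :=
  ∑ d : Fin n, ∑ i : G.I (d + 1), ∑ t : (M.sub (d + 1) i).ι, formCell P i t (u d i t) (v d i t)

/-- The diagonal part of `(K⁻¹ u, v)_Ω`. -/
def formΩDiag : ℝ :=
  ∑ d : Fin n, ∑ i : G.I (d + 1), ∑ t : (M.sub (d + 1) i).ι,
    formCellDiag P i t (u d i t) (v d i t)

theorem formΩ_self_nonneg : 0 ≤ formΩ P u u :=
  Finset.sum_nonneg fun _ _ => Finset.sum_nonneg fun i _ => Finset.sum_nonneg fun t _ =>
    formCell_self_nonneg P i t _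

variable {u} in
theorem eq_zero_of_formΩ_self_eq_zero (h : formΩ P u u = 0) : u = 0 := by
  rw [formΩ, ← Fintype.sum_sigma', ← Fintype.sum_sigma',
    Fintype.sum_eq_zero_iff_of_nonneg fun _ => formCell_self_nonneg P _ _ _] at h
  funext d i t
  exact eq_zero_of_formCell_self_eq_zero P i t (congrFun h ⟨⟨d, i⟩, t⟩)

theorem formΩ_self_le : formΩ P u u ≤ (n + 1) * formΩDiag P u u := by
  simp only [formΩ, formΩDiag, Finset.mul_sum]
  refine Finset.sum_le_sum fun d _ => Finset.sum_le_sum fun i _ => Finset.sum_le_sum fun t _ =>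
    (formCell_self_le P i t _).trans
      (mul_le_mul_of_nonneg_right ?_ (formCellDiag_self_nonneg P i t _))
  exact_mod_cast (by omega : (d : ℕ) + 2 ≤ n + 1)

end Omega

theorem flux_add {d : ℕ} (v w : M.Xd d) (i : G.I (d + 1)) (t : (M.sub (d + 1) i).ι)
    (k : Fin (d + 2)) : flux (v + w) i t k = flux v i t k + flux w i t k :=
  congrFun (map_add (RT.fluxMap ((M.sub (d + 1) i).cell t)) (v i t) (w i t)) k

theorem flux_smul {d : ℕ} (c : ℝ) (v : M.Xd d) (i : G.I (d + 1)) (t : (M.sub (d + 1) i).ι)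
    (k : Fin (d + 2)) : flux (c • v) i t k = c * flux v i t k :=
  congrFun (map_smul (RT.fluxMap ((M.sub (d + 1) i).cell t)) c (v i t)) k

theorem formΓ_comm (l m : M.L) : formΓ P l m = formΓ P m l := by
  simp only [formΓ, mul_right_comm]

theorem formΓ_add_left (l l' m : M.L) : formΓ P (l + l') m = formΓ P l m + formΓ P l' m := by
  simp only [formΓ_eq_sum_mortarWeight, Pi.add_apply, add_mul, mul_add, Finset.sum_add_distrib]

theorem formΓ_smul_left (c : ℝ) (l m : M.L) : formΓ P (c • l) m = c * formΓ P l m := by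
  simp only [formΓ_eq_sum_mortarWeight, Pi.smul_apply, smul_eq_mul, Finset.mul_sum, mul_left_comm,
    mul_assoc]

variable (R : ∀ d : Fin n, M.Ld d →ₗ[ℝ] M.Vd d)

theorem total_add (w r : M.W) (d : Fin n) : total R (w + r) d = total R w d + total R r d := by
  simp only [total, Prod.fst_add, Prod.snd_add, Pi.add_apply, map_add, Submodule.coe_add]
  abel

theorem total_smul (c : ℝ) (r : M.W) (d : Fin n) : total R (c • r) d = c • total R r d := by
  simp only [total, Prod.smul_fst, Prod.smul_snd, Pi.smul_apply, map_smul, Submodule.coe_smul,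
    smul_add]

theorem a_eq_formΩ_add_formΓ (w r : M.W) :
    a P R w r = formΩ P (total R w) (total R r) + formΓ P w.2 r.2 := rfl

theorem aD_eq_formΩDiag_add_formΓ (w r : M.W) :
    aD P R w r = formΩDiag P (total R w) (total R r) + formΓ P w.2 r.2 := rfl

theorem a_self_nonneg (r : M.W) : 0 ≤ a P R r r :=
  add_nonneg (formΩ_self_nonneg P _) (formΓ_self_nonneg P _)

theorem eq_zero_of_a_self_eq_zero {r : M.W} (h : a P R r r = 0) : r = 0 := by
  obtain ⟨hΩ, hΓ⟩ :=
    (add_eq_zero_iff_of_nonneg (formΩ_self_nonneg P (total R r)) (formΓ_self_nonneg P r.2)).1 h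
  have hmortar : r.2 = 0 := eq_zero_of_formΓ_self_eq_zero P hΓ
  have htotal : total R r = 0 := eq_zero_of_formΩ_self_eq_zero P hΩ
  refine Prod.ext (funext fun d => Subtype.ext ?_) hmortar
  simpa [total, hmortar] using congrFun htotal d

theorem a_self_le (r : M.W) : a P R r r ≤ (n + 1) * aD P R r r := by
  rw [a_eq_formΩ_add_formΓ, aD_eq_formΩDiag_add_formΓ, mul_add]
  exact add_le_add (formΩ_self_le P _)
    (le_mul_of_one_le_left (formΓ_self_nonneg P _) (by simp))

theorem aD_comm (w r : M.W) : aD P R w r = aD P R r w := by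
  simp only [aD, formΓ_comm P w.2, mul_comm (flux (total R w _) _ _ _)]

theorem aD_add_left (w w' r : M.W) : aD P R (w + w') r = aD P R w r + aD P R w' r := by
  simp only [aD, total_add, flux_add, add_mul, Finset.sum_add_distrib, Prod.snd_add,
    formΓ_add_left]
  exact add_add_add_comm _ _ _ _

theorem aD_smul_left (c : ℝ) (w r : M.W) : aD P R (c • w) r = c * aD P R w r := by
  simp only [aD, total_smul, flux_smul, Prod.smul_snd, formΓ_smul_left, mul_assoc,
    ← Finset.mul_sum, ← mul_add]

/-- `a^D` as a bilinear form. -/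
def aDMap : LinearMap.BilinForm ℝ M.W :=
  .mk₂ ℝ (aD P R) (aD_add_left P R) (aD_smul_left P R)
    (fun w r r' => by simp only [aD_comm P R w, aD_add_left])
    (fun c w r => by simp only [aD_comm P R w, aD_smul_left, smul_eq_mul])

theorem aD_self_nonneg (r : M.W) : 0 ≤ aD P R r r :=
  nonneg_of_mul_nonneg_right ((a_self_nonneg P R r).trans (a_self_le P R r)) (by positivity)

theorem eq_zero_of_aD_self_eq_zero {r : M.W} (h : aD P R r r = 0) : r = 0 :=
  eq_zero_of_a_self_eq_zero P R <|
    ((a_self_le P R r).trans_eq (by rw [h, mul_zero])).antisymm (a_self_nonneg P R r)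

theorem nondegenerate_aDMap : (aDMap P R).Nondegenerate :=
  nondegenerate_of_anisotropic fun _ => eq_zero_of_aD_self_eq_zero P R

/-! ### The form `b` -/

theorem jump_add {d : ℕ} (m m' : M.Ld d) (i : G.I d) (x : Space n) :
    jump (m + m') i x = jump m i x + jump m' i x := by
  simp only [jump, Pi.add_apply, Triangulation.toFun_add, Finset.sum_add_distrib, neg_add]

theorem jump_smul {d : ℕ} (c : ℝ) (m : M.Ld d) (i : G.I d) (x : Space n) :
    jump (c • m) i x = c * jump m i x := by
  simp only [jump, Pi.smul_apply, Triangulation.toFun_smul, Finset.mul_sum, mul_neg]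

theorem integrableOn_toFun_mul_jump {d : ℕ} (i : G.I d) (q : (M.sub d i).ι → ℝ) (m : M.Ld d) :
    IntegrableOn (fun x => (M.sub d i).toFun q x * jump m i x) (G.dom d i) μHE[d] := by
  have := (M.sub d i).isFiniteMeasure_restrict_dom
  have hjump : IntegrableOn (jump m i) (G.dom d i) μHE[d] :=
    (integrable_finsetSum _ fun _ _ => Triangulation.integrable_toFun _ _ _).neg
  exact hjump.bdd_mul ((M.sub d i).measurable_toFun q).aestronglyMeasurable
    (.of_forall ((M.sub d i).norm_toFun_le q))

theorem integral_toFun_mul_jump_add {d : ℕ} (i : G.I d) (q : (M.sub d i).ι → ℝ) (m m' : M.Ld d) :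
    ∫ x in G.dom d i, (M.sub d i).toFun q x * jump (m + m') i x ∂μHE[d] =
      (∫ x in G.dom d i, (M.sub d i).toFun q x * jump m i x ∂μHE[d]) +
        ∫ x in G.dom d i, (M.sub d i).toFun q x * jump m' i x ∂μHE[d] := by
  simp only [jump_add, mul_add]
  exact integral_add (integrableOn_toFun_mul_jump i q m) (integrableOn_toFun_mul_jump i q m')

theorem integral_toFun_add_mul_jump {d : ℕ} (i : G.I d) (q q' : (M.sub d i).ι → ℝ) (m : M.Ld d) :
    ∫ x in G.dom d i, (M.sub d i).toFun (q + q') x * jump m i x ∂μHE[d] =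
      (∫ x in G.dom d i, (M.sub d i).toFun q x * jump m i x ∂μHE[d]) +
        ∫ x in G.dom d i, (M.sub d i).toFun q' x * jump m i x ∂μHE[d] := by
  simp only [Triangulation.toFun_add, add_mul]
  exact integral_add (integrableOn_toFun_mul_jump i q m) (integrableOn_toFun_mul_jump i q' m)

theorem b_add_left (r r' : M.W) (q : M.Q) : b R (r + r') q = b R r q + b R r' q := by
  simp only [b, total_add, RT.div, Prod.snd_add, Pi.add_apply, integral_toFun_mul_jump_add,
    integral_const, smul_eq_mul, mul_add, Finset.sum_add_distrib]
  ring

theorem b_smul_left (c : ℝ) (r : M.W) (q : M.Q) : b R (c • r) q = c * b R r q := by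
  simp only [b, Prod.smul_snd, Pi.smul_apply, jump_smul, total_smul, RT.div, smul_eq_mul,
    mul_left_comm _ c, integral_const_mul, ← Finset.mul_sum, ← mul_add, mul_neg]

theorem b_add_right (r : M.W) (q q' : M.Q) : b R r (q + q') = b R r q + b R r q' := by
  simp only [b, Pi.add_apply, integral_toFun_add_mul_jump, integral_const, smul_eq_mul, add_mul,
    mul_add, Finset.sum_add_distrib]
  ring

theorem b_smul_right (c : ℝ) (r : M.W) (q : M.Q) : b R r (c • q) = c * b R r q := by
  simp only [b, Pi.smul_apply, Triangulation.toFun_smul, smul_eq_mul, mul_assoc c,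
    integral_const_mul, ← Finset.mul_sum, ← mul_add, mul_neg]

/-- `b` as a bilinear map, with the arguments in the order `(q, r)`. -/
def bMap : M.Q →ₗ[ℝ] M.W →ₗ[ℝ] ℝ :=
  .mk₂ ℝ (fun q r => b R r q) (fun q q' r => b_add_right R r q q')
    (fun c q r => b_smul_right R c r q) (fun q r r' => b_add_left R r r' q)
    (fun c q r => b_smul_left R c r q)

/-! ### The discrete gradient and the inf-sup condition -/

theorem existsUnique_isDiscreteGradient :
    ∃! D : M.Q →ₗ[ℝ] M.W, IsDiscreteGradient P R D :=
  existsUnique_linearMap_apply_eq (nondegenerate_aDMap P R) (bMap R)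

theorem normA_le_sqrt_mul_normAD (r : M.W) : normA P R r ≤ √(n + 1) * normAD P R r := by
  rw [normA, normAD, ← Real.sqrt_mul (by positivity)]
  exact Real.sqrt_le_sqrt (a_self_le P R r)

theorem normA_pos {r : M.W} (hr : r ≠ 0) : 0 < normA P R r :=
  Real.sqrt_pos.2 <| (a_self_nonneg P R r).lt_of_ne' (mt (eq_zero_of_a_self_eq_zero P R) hr)

theorem normAD_pos {r : M.W} (hr : r ≠ 0) : 0 < normAD P R r :=
  Real.sqrt_pos.2 <| (aD_self_nonneg P R r).lt_of_ne' (mt (eq_zero_of_aD_self_eq_zero P R) hr)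

theorem inv_le_aD_self_div {c : ℝ} {r : M.W} (hr : r ≠ 0)
    (h : normA P R r ≤ c * normAD P R r) :
    c⁻¹ ≤ aD P R r r / (normA P R r * normAD P R r) := by
  have hA := normA_pos P R hr
  have hAD := normAD_pos P R hr
  have hc : 0 < c := pos_of_mul_pos_left (hA.trans_le h) hAD.le
  calc c⁻¹ ≤ normAD P R r / normA P R r := by
        rwa [le_div_iff₀ hA, inv_mul_le_iff₀ hc]
    _ = normAD P R r * normAD P R r / (normA P R r * normAD P R r) :=
        (mul_div_mul_right _ _ hAD.ne').symm
    _ = aD P R r r / (normA P R r * normAD P R r) := by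
        rw [normAD, Real.mul_self_sqrt (aD_self_nonneg P R r)]

theorem inv_le_iSup_aD_div {c : ℝ} {w : M.W} (hw : w ≠ 0)
    (h : normA P R w ≤ c * normAD P R w) :
    ((c⁻¹ : ℝ) : EReal) ≤ ⨆ r : {r : M.W // r ≠ 0},
      ((aD P R w r / (normA P R r * normAD P R w) : ℝ) : EReal) :=
  le_iSup_of_le ⟨w, hw⟩ (EReal.coe_le_coe_iff.2 (inv_le_aD_self_div P R hw h))

end Mesh

end MixedDim

end

open MixedDim Mesh in
theorem mainTheorem3_general {n : ℕ} {G : Geometry n} (M : Mesh G) (P : Params G) {c₂ : ℝ}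
    (hc₂ : √(n + 1) ≤ c₂) :
    (∃ R : ∀ d : Fin n, M.Ld d →ₗ[ℝ] M.Vd d, ∀ d : Fin n, M.IsExtension d (R d)) ∧
    ∀ R : ∀ d : Fin n, M.Ld d →ₗ[ℝ] M.Vd d,
      (∀ r : M.W, normA P R r ≤ c₂ * normAD P R r) ∧
      (∃! D : M.Q →ₗ[ℝ] M.W, IsDiscreteGradient P R D) ∧
      ∀ D : M.Q →ₗ[ℝ] M.W, IsDiscreteGradient P R D →
        ((c₂⁻¹ : ℝ) : EReal) ≤ ⨅ q : {q : M.Q // D q ≠ 0}, ⨆ r : {r : M.W // r ≠ 0},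
          ((aD P R (D q) r / (normA P R r * normAD P R (D q)) : ℝ) : EReal) := by
  refine ⟨⟨fun d => extension M d, fun d => isExtension_extension M d⟩, fun R => ?_⟩
  have hnorm (r : M.W) : normA P R r ≤ c₂ * normAD P R r :=
    (normA_le_sqrt_mul_normAD P R r).trans
      (mul_le_mul_of_nonneg_right hc₂ (Real.sqrt_nonneg _))
  exact ⟨hnorm, existsUnique_isDiscreteGradient P R,
    fun D _ => le_iInf fun q => inv_le_iSup_aD_div P R q.2 (hnorm (D q))⟩

theorem mainTheorem3 (σ : ℝ) :
    ∃ c₂ : ℝ, 0 < c₂ ∧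
      ∀ (n : ℕ), n = 2 ∨ n = 3 →
      ∀ (G : MixedDim.Geometry n) (M : MixedDim.Mesh G) (P : MixedDim.Params G),
        M.ShapeRegular σ →
        (∃ R : ∀ d : Fin n, M.Ld d →ₗ[ℝ] M.Vd d, ∀ d : Fin n, M.IsExtension d (R d)) ∧
        ∀ R : ∀ d : Fin n, M.Ld d →ₗ[ℝ] M.Vd d, (∀ d : Fin n, M.IsExtension d (R d)) →
          (∀ r : M.W, MixedDim.Mesh.normA P R r ≤ c₂ * MixedDim.Mesh.normAD P R r) ∧
          (∃! D : M.Q →ₗ[ℝ] M.W, MixedDim.Mesh.IsDiscreteGradient P R D) ∧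
          ∀ D : M.Q →ₗ[ℝ] M.W, MixedDim.Mesh.IsDiscreteGradient P R D →
            ((c₂⁻¹ : ℝ) : EReal) ≤
              ⨅ q : {q : M.Q // D q ≠ 0}, ⨆ r : {r : M.W // r ≠ 0},
                ((MixedDim.Mesh.aD P R (D q) r /
                  (MixedDim.Mesh.normA P R r * MixedDim.Mesh.normAD P R (D q)) : ℝ) : EReal) := by
  refine ⟨2, two_pos, fun n hn G M P _ => ?_⟩
  have hsqrt : √((n : ℝ) + 1) ≤ 2 := by
    rw [Real.sqrt_le_left two_pos.le]
    rcases hn with rfl | rfl <;> norm_num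
  exact (mainTheorem3_general M P hsqrt).imp_right fun h R _ => h R
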